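/- Let $d\ge 1$, let $\mathcal K\subset\mathbb R^{d+1}$ be a convex body (a nonempty compact convex set), and let $\mathfrak m_2,\mathfrak M_2>0$. For $x\in\partial\mathcal K$, a sphere is said to be tangent to $\partial\mathcal K$ at $x$ if it has positive radius, passes through $x$, and its tangent hyperplane at $x$ is a supporting hyperplane of $\mathcal K$. The inner radius of curvature at $x$ is the supremum of the radii of the spheres in $\mathbb R^{d+1}$ that are tangent to $\partial\mathcal K$ at $x$ and contained in $\mathcal K$ (it is $0$ if there are none); the outer radius of curvature at $x$ is the infimum of the radii of the spheres that are tangent to $\partial\mathcal K$ at $x$ and enclose $\mathcal K$ (it is $\infty$ if there are none). Suppose that at every $x\in\partial\mathcal K$ the inner radius of curvature is at least $\frac{1}{\sqrt{\mathfrak M_2}}$ and the outer radius of curvature is at most $\frac{1}{\sqrt{\mathfrak m_2}}$. For $x,y\in\partial\mathcal K$ let $$\mathrm{dist}_{\partial\mathcal K}(x,y)=\inf_\gamma\int_0^1\|\gamma'(t)\|\,dt$$ be the geodesic distance, the infimum being over all continuously differentiable paths $\gamma:[0,1]\to\partial\mathcal K$ with $\gamma(0)=x$ and $\gamma(1)=y$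 (and $\inf\emptyset=\infty$). Then for all $q^{(1)},q^{(2)}\in\partial\mathcal K$, $$\mathrm{dist}_{\partial\mathcal K}(q^{(1)},q^{(2)})\le 2\pi\,\frac{\sqrt{\mathfrak M_2}}{\sqrt{\mathfrak m_2}}\,\bigl\|q^{(2)}-q^{(1)}\bigr\|.$$ -/

import Mathlib

open scoped ENNReal

/-- The sphere of center `c` and radius `ρ > 0` is tangent at `x` to the boundary of the convex
set `K`: it passes through `x`, and its tangent hyperplane `{y | ⟪x - c, y - x⟫ = 0}` at `x` has
`K` on one side, that is, it is a supporting hyperplane of `K` at `x` (when the boundary of `K` is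
differentiable at `x`, the only such hyperplane is the tangent hyperplane of the boundary). -/
def IsTangentSphere {E : Type*} [NormedAddCommGroup E] [InnerProductSpace ℝ E]
    (K : Set E) (x c : E) (ρ : ℝ) : Prop :=
  0 < ρ ∧ x ∈ Metric.sphere c ρ ∧
    ((∀ y ∈ K, inner ℝ (x - c) (y - x) ≤ 0) ∨ (∀ y ∈ K, 0 ≤ inner ℝ (x - c) (y - x)))

/-- The inner radius of curvature of `K` at the boundary point `x`: the largest radius of a sphere
that is tangent to the boundary of `K` at `x` and contained in `K` (`0` if there is none). -/
noncomputable def innerRadiusOfCurvature {E : Type*} [NormedAddCommGroup E]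
    [InnerProductSpace ℝ E] (K : Set E) (x : E) : ℝ≥0∞ :=
  sSup {r | ∃ (c : E) (ρ : ℝ), IsTangentSphere K x c ρ ∧ Metric.sphere c ρ ⊆ K ∧
    r = ENNReal.ofReal ρ}

/-- The outer radius of curvature of `K` at the boundary point `x`: the smallest radius of a sphere
that is tangent to the boundary of `K` at `x` and encloses `K` (`∞` if there is none). -/
noncomputable def outerRadiusOfCurvature {E : Type*} [NormedAddCommGroup E]
    [InnerProductSpace ℝ E] (K : Set E) (x : E) : ℝ≥0∞ :=
  sInf {r | ∃ (c : E) (ρ : ℝ), IsTangentSphere K x c ρ ∧ K ⊆ Metric.closedBall c ρ ∧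
    r = ENNReal.ofReal ρ}

/-- The length `∫₀¹ ‖γ'(t)‖ dt` of a path `γ` on `[0, 1]`. -/
noncomputable def pathLength {E : Type*} [NormedAddCommGroup E] [NormedSpace ℝ E]
    (γ : ℝ → E) : ℝ≥0∞ :=
  ∫⁻ t in Set.Icc (0 : ℝ) 1, ‖derivWithin γ (Set.Icc 0 1) t‖ₑ

/-- `γ` restricted to `[0, 1]` is a continuously differentiable path from `x` to `y` that stays
in `S`. -/
def IsC1PathIn {E : Type*} [NormedAddCommGroup E] [NormedSpace ℝ E]
    (S : Set E) (x y : E) (γ : ℝ → E) : Prop :=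
  ContDiffOn ℝ 1 γ (Set.Icc 0 1) ∧ Set.MapsTo γ (Set.Icc 0 1) S ∧ γ 0 = x ∧ γ 1 = y

/-- The intrinsic (geodesic) distance between `x` and `y` in `S`, for the metric induced by the
ambient space: the infimum of the lengths of the paths from `x` to `y` in `S` (`∞` if there is
no such path). -/
noncomputable def geodesicDist {E : Type*} [NormedAddCommGroup E] [NormedSpace ℝ E]
    (S : Set E) (x y : E) : ℝ≥0∞ :=
  ⨅ (γ : ℝ → E) (_ : IsC1PathIn S x y γ), pathLength γ

section RollingBalls

open Set Metric Filter Topology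
open scoped RealInnerProductSpace

variable {E : Type*} [NormedAddCommGroup E] [InnerProductSpace ℝ E]

/-! Fix `ρ` below all inner radii and `R` above all outer ones. At each boundary point an inner ball
of radius `ρ` and an outer ball of radius `R` touch with a common unit normal `N`. Take the origin
at the centre of one inner ball and project great-circle arcs radially onto the boundary.

The inner balls make `N` Lipschitz, so the supporting functionals vary continuously, the gauge is C¹
away from the origin, and so is the projection. If the ray to a boundary point `x` makes angle `α`
with `N x`, an arc run at unit speed is projected with speed at most `‖x‖ / cos α = ‖x‖² / ⟪N x,
x⟫`, and this is at most `2 R` because the outer ball at `x` contains the origin. Boundary points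
have norm at least `ρ`, so those at angle `φ` are at distance at least `2 ρ φ / π`. Hence the length
is at most `2 R φ ≤ π (R / ρ) ‖y - x‖`. -/

/-- A function that dominates a continuously varying family of linear functionals, and is touched
at each point by the functional attached to it, is differentiable. -/
theorem hasFDerivAt_of_supporting {g : E → ℝ} {L : E → E →L[ℝ] ℝ} {s : Set E} {x : E}
    (hs : s ∈ 𝓝 x) (heq : ∀ y ∈ s, L y y = g y) (hle : ∀ y ∈ s, ∀ z ∈ s, L y z ≤ g z)
    (hL : ContinuousAt L x) : HasFDerivAt g (L x) x := by
  rw [hasFDerivAt_iff_isLittleO, Asymptotics.isLittleO_iff]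
  intro ε hε
  have hx := mem_of_mem_nhds hs
  filter_upwards [hs, hL (Metric.ball_mem_nhds (L x) hε)] with y hy hLy
  have h₁ := hle x hx y hy
  have h₂ := hle y hy x hx
  -- Support at `x` and at `y` squeezes the remainder: `0 ≤ g y - g x - L x (y - x) ≤ (L y - L x) (y
  -- - x)`.
  have h₃ : (L y - L x) (y - x) ≤ ε * ‖y - x‖ := by
    have hlt : ‖L y - L x‖ < ε := by simpa [dist_eq_norm] using hLy
    exact (le_abs_self _).trans ((L y - L x).le_of_opNorm_le hlt.le _)
  have e₁ := heq x hx
  have e₂ := heq y hy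
  simp only [map_sub, sub_apply] at h₃ ⊢
  rw [Real.norm_eq_abs, abs_le]
  have := mul_nonneg hε.le (norm_nonneg (y - x))
  constructor <;> linarith

/-- The convex body `S` contains the ball of radius `ρ` around the origin, and at each of its
boundary points `x` it contains a ball of radius `ρ` and lies in a ball of radius `R`, both with
outward unit normal `N x` at `x`. -/
structure IsPinchedByBalls (S : Set E) (N : E → E) (ρ R : ℝ) : Prop where
  convex : Convex ℝ S
  isClosed : IsClosed S
  isBounded : Bornology.IsBounded S
  inner_pos : 0 < ρ
  outer_pos : 0 < R
  closedBall_subset : closedBall 0 ρ ⊆ S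
  norm_normal : ∀ x ∈ frontier S, ‖N x‖ = 1
  inner_ball : ∀ x ∈ frontier S, closedBall (x - ρ • N x) ρ ⊆ S
  outer_ball : ∀ x ∈ frontier S, S ⊆ closedBall (x - R • N x) R

/-- The radial projection from the origin onto the boundary of `S`. -/
noncomputable def radialProj (S : Set E) (y : E) : E := (gauge S y)⁻¹ • y

/-- The linear functional that equals `1` on the supporting hyperplane at the radial projection
of `y`. -/
noncomputable def supportFunctional (S : Set E) (N : E → E) (y : E) : E →L[ℝ] ℝ :=
  (⟪N (radialProj S y), radialProj S y⟫)⁻¹ • innerSL ℝ (N (radialProj S y))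

/-! ### Support inequalities and continuity of the normal -/

namespace IsPinchedByBalls

variable {S : Set E} {N : E → E} {ρ R : ℝ}

theorem inner_sub_le (h : IsPinchedByBalls S N ρ R) {x y : E} (hx : x ∈ frontier S) (hy : y ∈ S) :
    ‖y - x‖ ^ 2 ≤ 2 * R * ⟪N x, x - y⟫ := by
  have h₁ := h.outer_ball x hx hy
  rw [mem_closedBall, dist_eq_norm] at h₁
  have h₂ : ‖(y - x) + R • N x‖ ^ 2 ≤ R ^ 2 := by
    rw [show y - x + R • N x = y - (x - R • N x) by abel]
    gcongr
  rw [norm_add_sq_real, norm_smul, h.norm_normal x hx, inner_smul_right, mul_one, Real.norm_eq_abs,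
    sq_abs] at h₂
  rw [← neg_sub y x, inner_neg_right, real_inner_comm]
  linarith

theorem inner_le (h : IsPinchedByBalls S N ρ R) {x y : E} (hx : x ∈ frontier S) (hy : y ∈ S) :
    ⟪N x, y⟫ ≤ ⟪N x, x⟫ := by
  have h₁ := (sq_nonneg _).trans (h.inner_sub_le hx hy)
  have h₂ := nonneg_of_mul_nonneg_right h₁ (mul_pos two_pos h.outer_pos)
  rw [inner_sub_right] at h₂
  linarith

theorem norm_sq_le (h : IsPinchedByBalls S N ρ R) {x : E} (hx : x ∈ frontier S) :
    ‖x‖ ^ 2 ≤ 2 * R * ⟪N x, x⟫ := by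
  simpa using h.inner_sub_le hx (h.closedBall_subset (mem_closedBall_self h.inner_pos.le))

theorem le_inner (h : IsPinchedByBalls S N ρ R) {x : E} (hx : x ∈ frontier S) :
    ρ ≤ ⟪N x, x⟫ := by
  have h₁ : ρ • N x ∈ S := h.closedBall_subset (by
    simp [norm_smul, h.norm_normal x hx, abs_of_pos h.inner_pos])
  simpa [inner_smul_right, h.norm_normal x hx] using h.inner_le hx h₁

theorem inner_self_pos (h : IsPinchedByBalls S N ρ R) {x : E} (hx : x ∈ frontier S) :
    0 < ⟪N x, x⟫ :=
  h.inner_pos.trans_le (h.le_inner hx)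

theorem le_norm (h : IsPinchedByBalls S N ρ R) {x : E} (hx : x ∈ frontier S) : ρ ≤ ‖x‖ := by
  refine (h.le_inner hx).trans ((real_inner_le_norm _ _).trans ?_)
  rw [h.norm_normal x hx, one_mul]

/-- The point of the inner ball at `x` farthest in direction `N y` still obeys the support
inequality at `y`. -/
theorem inner_normal_le (h : IsPinchedByBalls S N ρ R) {x y : E} (hx : x ∈ frontier S)
    (hy : y ∈ frontier S) : ρ * (1 - ⟪N x, N y⟫) ≤ ⟪N y, y - x⟫ := by
  have h₁ : x - ρ • N x + ρ • N y ∈ S := h.inner_ball x hx (by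
    rw [mem_closedBall, dist_eq_norm, add_sub_cancel_left, norm_smul, h.norm_normal y hy,
      Real.norm_of_nonneg h.inner_pos.le, mul_one])
  have h₂ := h.inner_le hy h₁
  rw [inner_add_right, inner_sub_right, inner_smul_right, inner_smul_right,
    real_inner_self_eq_norm_sq, h.norm_normal y hy, real_inner_comm (N x)] at h₂
  rw [inner_sub_right]
  linarith

/-- Add `inner_normal_le` to its mirror image and apply Cauchy–Schwarz. -/
theorem norm_normal_sub_le (h : IsPinchedByBalls S N ρ R) {x y : E} (hx : x ∈ frontier S)
    (hy : y ∈ frontier S) : ‖N x - N y‖ ≤ ρ⁻¹ * ‖x - y‖ := by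
  have h₁ := h.inner_normal_le hx hy
  have h₂ := h.inner_normal_le hy hx
  have h₃ : ‖N x - N y‖ ^ 2 = 2 * (1 - ⟪N x, N y⟫) := by
    rw [norm_sub_sq_real, h.norm_normal x hx, h.norm_normal y hy]; ring
  have h₄ := real_inner_le_norm (N x - N y) (x - y)
  rw [inner_sub_left] at h₄
  rw [← neg_sub x y, inner_neg_right] at h₁
  rw [real_inner_comm] at h₂
  have h₅ : ρ * ‖N x - N y‖ ^ 2 ≤ ‖N x - N y‖ * ‖x - y‖ := by rw [h₃]; linarith
  rw [inv_mul_eq_div, le_div_iff₀' h.inner_pos]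
  rcases (norm_nonneg (N x - N y)).eq_or_lt with h₀ | h₀
  · rw [← h₀]; simp
  · exact le_of_mul_le_mul_left (by linarith) h₀

theorem continuousOn_normal (h : IsPinchedByBalls S N ρ R) : ContinuousOn N (frontier S) :=
  (LipschitzOnWith.of_dist_le_mul (K := Real.toNNReal ρ⁻¹) fun x hx y hy => by
    rw [dist_eq_norm, dist_eq_norm, Real.coe_toNNReal _ (inv_nonneg.2 h.inner_pos.le)]
    exact h.norm_normal_sub_le hx hy).continuousOn

/-! ### Smoothness of the gauge and of the radial projection -/

theorem mem_nhds_zero (h : IsPinchedByBalls S N ρ R) : S ∈ 𝓝 0 :=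
  mem_of_superset (closedBall_mem_nhds 0 h.inner_pos) h.closedBall_subset

theorem gauge_pos (h : IsPinchedByBalls S N ρ R) {y : E} (hy : y ≠ 0) : 0 < gauge S y :=
  (_root_.gauge_pos (absorbent_nhds_zero h.mem_nhds_zero)
    (NormedSpace.isVonNBounded_of_isBounded ℝ h.isBounded)).2 hy

theorem radialProj_mem_frontier (h : IsPinchedByBalls S N ρ R) {y : E} (hy : y ≠ 0) :
    radialProj S y ∈ frontier S := by
  have hg := h.gauge_pos hy
  rw [← gauge_eq_one_iff_mem_frontier h.convex h.mem_nhds_zero, radialProj,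
    gauge_smul_of_nonneg (inv_nonneg.2 hg.le), smul_eq_mul, inv_mul_cancel₀ hg.ne']

theorem radialProj_smul (h : IsPinchedByBalls S N ρ R) {x : E} (hx : x ∈ frontier S) {a : ℝ}
    (ha : 0 < a) : radialProj S (a • x) = x := by
  have h₁ := (gauge_eq_one_iff_mem_frontier h.convex h.mem_nhds_zero).2 hx
  rw [radialProj, gauge_smul_of_nonneg ha.le, h₁, smul_eq_mul, mul_one, smul_smul,
    inv_mul_cancel₀ ha.ne', one_smul]

theorem continuousOn_radialProj (h : IsPinchedByBalls S N ρ R) :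
    ContinuousOn (radialProj S) {0}ᶜ :=
  ((continuous_gauge h.convex h.mem_nhds_zero).continuousOn.inv₀
    fun _ hy => (h.gauge_pos hy).ne').smul continuousOn_id

theorem continuousOn_supportFunctional (h : IsPinchedByBalls S N ρ R) :
    ContinuousOn (supportFunctional S N) {0}ᶜ := by
  have hN : ContinuousOn (fun y => N (radialProj S y)) {0}ᶜ :=
    h.continuousOn_normal.comp h.continuousOn_radialProj fun _ hy => h.radialProj_mem_frontier hy
  exact ((hN.inner h.continuousOn_radialProj).inv₀ fun _ hy =>
    (h.inner_self_pos (h.radialProj_mem_frontier hy)).ne').smul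
      ((innerSL ℝ : E →L⋆[ℝ] E →L[ℝ] ℝ).continuous.comp_continuousOn hN)

theorem supportFunctional_apply_self (h : IsPinchedByBalls S N ρ R) {y : E} (hy : y ≠ 0) :
    supportFunctional S N y y = gauge S y := by
  have h₁ := (h.inner_self_pos (h.radialProj_mem_frontier hy)).ne'
  have h₂ : y = gauge S y • radialProj S y := by
    rw [radialProj, smul_smul, mul_inv_cancel₀ (h.gauge_pos hy).ne', one_smul]
  calc supportFunctional S N y y = supportFunctional S N y (gauge S y • radialProj S y) := by
        rw [← h₂]
    _ = gauge S y := by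
        rw [map_smul, supportFunctional]
        simp [inv_mul_cancel₀ h₁]

theorem supportFunctional_apply_le (h : IsPinchedByBalls S N ρ R) {y z : E} (hy : y ≠ 0)
    (hz : z ≠ 0) : supportFunctional S N y z ≤ gauge S z := by
  have hx := h.radialProj_mem_frontier hy
  have h₁ := h.inner_le hx (h.isClosed.frontier_subset (h.radialProj_mem_frontier hz))
  rw [radialProj.eq_def S z, inner_smul_right, inv_mul_le_iff₀ (h.gauge_pos hz)] at h₁
  rw [supportFunctional]
  simp only [smul_apply, innerSL_apply_apply, smul_eq_mul]
  rw [inv_mul_le_iff₀ (h.inner_self_pos hx)]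
  linarith

theorem hasFDerivAt_gauge (h : IsPinchedByBalls S N ρ R) {y : E} (hy : y ≠ 0) :
    HasFDerivAt (gauge S) (supportFunctional S N y) y :=
  have hs : ({0}ᶜ : Set E) ∈ 𝓝 y := isOpen_compl_singleton.mem_nhds hy
  hasFDerivAt_of_supporting hs (fun _ hz => h.supportFunctional_apply_self hz)
    (fun _ hz _ hw => h.supportFunctional_apply_le hz hw)
    (h.continuousOn_supportFunctional.continuousAt hs)

theorem contDiffOn_gauge (h : IsPinchedByBalls S N ρ R) :
    ContDiffOn ℝ 1 (gauge S) {0}ᶜ := by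
  rw [show (1 : WithTop ℕ∞) = 0 + 1 from rfl,
    contDiffOn_succ_iff_fderiv_of_isOpen isOpen_compl_singleton]
  refine ⟨fun y hy => (h.hasFDerivAt_gauge hy).differentiableAt.differentiableWithinAt, by simp, ?_⟩
  exact contDiffOn_zero.2 (h.continuousOn_supportFunctional.congr
    fun y hy => (h.hasFDerivAt_gauge hy).fderiv)

theorem contDiffOn_radialProj (h : IsPinchedByBalls S N ρ R) :
    ContDiffOn ℝ 1 (radialProj S) {0}ᶜ :=
  (h.contDiffOn_gauge.inv fun _ hy => (h.gauge_pos hy).ne').smul contDiffOn_id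

/-! ### Speed of projected arcs, and angle against chord -/

theorem norm_deriv_radialProj_le (h : IsPinchedByBalls S N ρ R) {c : ℝ → E} {c' : E} {t : ℝ}
    (hc : HasDerivAt c c' t) (h₁ : ‖c t‖ = 1) (h₂ : ‖c'‖ = 1) (h₃ : ⟪c t, c'⟫ = 0) :
    ‖deriv (fun s => radialProj S (c s)) t‖ ≤ 2 * R := by
  have h₀ : c t ≠ 0 := norm_ne_zero_iff.1 (by simp [h₁])
  have hg := h.gauge_pos h₀
  have hx := h.radialProj_mem_frontier h₀
  have hD := (((h.hasFDerivAt_gauge h₀).comp_hasDerivAt t hc).inv hg.ne').smul hc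
  have hD' : deriv (fun s => radialProj S (c s)) t = _ := hD.deriv
  rw [hD']
  clear hD hD'
  have hn := h.norm_normal _ hx
  have hp := h.inner_self_pos hx
  have hq := h.norm_sq_le hx
  simp only [Pi.inv_apply, Function.comp_apply, supportFunctional, smul_apply,
    innerSL_apply_apply, smul_eq_mul]
  generalize N (radialProj S (c t)) = n at *
  rw [radialProj] at *
  generalize gauge S (c t) = g at *
  generalize c t = e at *
  rw [inner_smul_right] at hp
  have ha : 0 < ⟪n, e⟫ := pos_of_mul_pos_right hp (inv_pos.2 hg).le
  -- Bessel's inequality for the orthonormal pair `e`, `c'`. It bounds the speed `g⁻¹ √(1 + b² /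
  -- a²)` by `(g a)⁻¹`.
  have hb : ⟪n, e⟫ ^ 2 + ⟪n, c'⟫ ^ 2 ≤ 1 := by
    have h₄ := real_inner_le_norm n (⟪n, e⟫ • e + ⟪n, c'⟫ • c')
    have h₅ : ‖⟪n, e⟫ • e + ⟪n, c'⟫ • c'‖ ^ 2 = ⟪n, e⟫ ^ 2 + ⟪n, c'⟫ ^ 2 := by
      rw [norm_add_sq_real, norm_smul, norm_smul, inner_smul_left, inner_smul_right, h₁, h₂, h₃]
      simp
    rw [inner_add_right, inner_smul_right, inner_smul_right, hn] at h₄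
    nlinarith [norm_nonneg (⟪n, e⟫ • e + ⟪n, c'⟫ • c')]
  rw [inner_smul_right, norm_smul, h₁, mul_one, Real.norm_of_nonneg (inv_pos.2 hg).le] at hq
  rw [inner_smul_right]
  generalize ⟪n, e⟫ = a at *
  generalize ⟪n, c'⟫ = b at *
  have hq' : (g * a)⁻¹ ≤ 2 * R := by
    field_simp at hq ⊢
    linarith
  refine le_trans (abs_le_of_sq_le_sq' ?_ (inv_pos.2 (mul_pos hg ha)).le).2 hq'
  rw [norm_add_sq_real, norm_smul, norm_smul, inner_smul_left, inner_smul_right, h₁, h₂,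
    real_inner_comm, h₃, Real.norm_eq_abs, Real.norm_eq_abs, mul_one, mul_one, sq_abs, sq_abs]
  field_simp
  simp
  linarith

/-- Two points of the boundary are joined by a path in the boundary, whose speed is at most `2 R`
times the angle between the points. -/
theorem exists_path (h : IsPinchedByBalls S N ρ R) {x v : E} {φ : ℝ} (hx : x ∈ frontier S)
    (hv : ‖v‖ = 1) (hxv : ⟪x, v⟫ = 0) :
    ∃ γ : ℝ → E, ContDiff ℝ 1 γ ∧ (∀ t, γ t ∈ frontier S) ∧ γ 0 = x ∧
      γ 1 = radialProj S ((Real.cos φ) • (‖x‖⁻¹ • x) + (Real.sin φ) • v) ∧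
      ∀ t, ‖deriv γ t‖ ≤ 2 * R * |φ| := by
  have hx₀ : 0 < ‖x‖ := h.inner_pos.trans_le (h.le_norm hx)
  have hu : ‖‖x‖⁻¹ • x‖ = 1 := by rw [norm_smul, norm_inv, norm_norm, inv_mul_cancel₀ hx₀.ne']
  have huv : ⟪‖x‖⁻¹ • x, v⟫ = 0 := by rw [inner_smul_left, hxv, mul_zero]
  have hend := h.radialProj_smul hx (inv_pos.2 hx₀)
  generalize ‖x‖⁻¹ • x = u at *
  have hnorm : ∀ a b : ℝ, a ^ 2 + b ^ 2 = 1 → ‖a • u + b • v‖ = 1 := fun a b hab => by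
    rw [← sq_eq_sq₀ (norm_nonneg _) zero_le_one, norm_add_sq_real, norm_smul, norm_smul,
      inner_smul_left, inner_smul_right, hu, hv, huv]
    simpa using hab
  let c : ℝ → E := fun θ => Real.cos θ • u + Real.sin θ • v
  have hc₁ : ∀ θ, ‖c θ‖ = 1 := fun θ => hnorm _ _ (Real.cos_sq_add_sin_sq θ)
  have hc₀ : ∀ θ, c θ ≠ 0 := fun θ => norm_ne_zero_iff.1 (by simp [hc₁])
  have hc : ∀ θ, HasDerivAt c (-Real.sin θ • u + Real.cos θ • v) θ := fun θ =>
    ((Real.hasDerivAt_cos θ).smul_const u).add ((Real.hasDerivAt_sin θ).smul_const v)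
  have hcd : ContDiff ℝ 1 c :=
    (Real.contDiff_cos.smul contDiff_const).add (Real.contDiff_sin.smul contDiff_const)
  have hp : ContDiff ℝ 1 fun θ => radialProj S (c θ) :=
    h.contDiffOn_radialProj.comp_contDiff hcd hc₀
  refine ⟨fun t => radialProj S (c (φ * t)), hp.comp (contDiff_const.mul contDiff_id),
    fun t => h.radialProj_mem_frontier (hc₀ _), by simp [c, hend], by simp [c], fun t => ?_⟩
  rw [deriv_comp_mul_left φ (fun θ => radialProj S (c θ)), norm_smul, Real.norm_eq_abs, mul_comm]
  gcongr
  refine h.norm_deriv_radialProj_le (hc _) (hc₁ _) (hnorm _ _ ?_) ?_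
  · rw [neg_sq, Real.sin_sq_add_cos_sq]
  · simp only [c, inner_add_left, inner_add_right, inner_smul_left, inner_smul_right, huv,
      real_inner_comm u v, real_inner_self_eq_norm_sq, hu, hv]
    simp
    ring

theorem angle_le (h : IsPinchedByBalls S N ρ R) {x y : E} (hx : x ∈ frontier S)
    (hy : y ∈ frontier S) :
    2 * ρ * InnerProductGeometry.angle x y ≤ Real.pi * ‖y - x‖ := by
  have h₁ := h.le_norm hx
  have h₂ := h.le_norm hy
  have hρ := h.inner_pos
  -- The Jordan-type bound `cos φ ≤ 1 - 2 φ² / π²` on `[0, π]`.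
  have hcos := Real.cos_le_one_sub_mul_cos_sq (x := InnerProductGeometry.angle x y) (by
    rw [abs_of_nonneg (InnerProductGeometry.angle_nonneg x y)]
    exact InnerProductGeometry.angle_le_pi x y)
  have hin := InnerProductGeometry.cos_angle_mul_norm_mul_norm x y
  have hsq := norm_sub_sq_real y x
  rw [real_inner_comm, ← hin] at hsq
  have hpi := Real.pi_pos
  have hle := Real.cos_le_one (InnerProductGeometry.angle x y)
  generalize InnerProductGeometry.angle x y = φ at *
  refine (abs_le_of_sq_le_sq' ?_ (by positivity)).2
  have h₃ : φ ^ 2 * 2 ≤ Real.pi ^ 2 * (1 - Real.cos φ) := by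
    field_simp at hcos
    linarith
  have h₄ : ρ * ρ ≤ ‖x‖ * ‖y‖ := mul_le_mul h₁ h₂ hρ.le (hρ.le.trans h₁)
  have h₅ : 2 * (ρ * ρ) * (1 - Real.cos φ) ≤ ‖y - x‖ ^ 2 := by
    rw [hsq]
    nlinarith [sq_nonneg (‖y‖ - ‖x‖), mul_le_mul_of_nonneg_right h₄ (sub_nonneg.2 hle)]
  calc (2 * ρ * φ) ^ 2 = 2 * (ρ * ρ) * (φ ^ 2 * 2) := by ring
    _ ≤ 2 * (ρ * ρ) * (Real.pi ^ 2 * (1 - Real.cos φ)) := by gcongr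
    _ = Real.pi ^ 2 * (2 * (ρ * ρ) * (1 - Real.cos φ)) := by ring
    _ ≤ Real.pi ^ 2 * ‖y - x‖ ^ 2 := by gcongr
    _ = _ := by ring

end IsPinchedByBalls

/-- In dimension at least two, every vector lies in an oriented plane through a given nonzero
vector, at the angle between the two. -/
theorem exists_unit_orthogonal_angle [FiniteDimensional ℝ E] (hE : 2 ≤ Module.finrank ℝ E)
    {x y : E} (hx : x ≠ 0) (hy : y ≠ 0) :
    ∃ v : E, ‖v‖ = 1 ∧ ⟪x, v⟫ = 0 ∧
      y = ‖y‖ • (Real.cos (InnerProductGeometry.angle x y) • (‖x‖⁻¹ • x) +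
        Real.sin (InnerProductGeometry.angle x y) • v) := by
  have hx' := norm_pos_iff.2 hx
  have hy' := norm_pos_iff.2 hy
  have hcos : Real.cos (InnerProductGeometry.angle x y) = ⟪x, y⟫ / (‖x‖ * ‖y‖) :=
    InnerProductGeometry.cos_angle x y
  set φ := InnerProductGeometry.angle x y
  have hyx : ⟪x, y⟫ = Real.cos φ * (‖x‖ * ‖y‖) := by rw [hcos]; field_simp
  set w : E := y - (‖y‖ * Real.cos φ * ‖x‖⁻¹) • x with hw
  have hxw : ⟪x, w⟫ = 0 := by
    rw [hw, inner_sub_right, inner_smul_right, real_inner_self_eq_norm_sq, hyx]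
    field_simp
    ring
  have hwn : ‖w‖ = ‖y‖ * Real.sin φ := by
    rw [← sq_eq_sq₀ (norm_nonneg _) (mul_nonneg hy'.le
      (InnerProductGeometry.sin_angle_nonneg x y)), hw, norm_sub_sq_real, inner_smul_right,
      real_inner_comm, hyx, norm_smul, Real.norm_eq_abs, mul_pow, sq_abs, mul_pow ‖y‖ (Real.sin φ),
      Real.sin_sq]
    field_simp
    ring
  have hyw : y = ‖y‖ • (Real.cos φ • (‖x‖⁻¹ • x)) + w := by
    simp only [hw, smul_smul, ← mul_assoc, add_sub_cancel]
  by_cases hw₀ : w = 0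
  -- Here `x` and `y` are collinear and the sine vanishes, so any unit vector orthogonal to `x`
  -- serves; this is where dimension two enters.
  · obtain ⟨z, hz, hz₀⟩ := Submodule.exists_mem_ne_zero_of_ne_bot (p := (ℝ ∙ x)ᗮ) (by
      intro hbot
      have h₁ := Submodule.finrank_add_finrank_orthogonal (ℝ ∙ x)
      rw [hbot, finrank_bot, finrank_span_singleton hx] at h₁
      omega)
    rw [hw₀, norm_zero] at hwn
    have hs : Real.sin φ = 0 := by
      rcases mul_eq_zero.1 hwn.symm with h₁ | h₁
      · exact absurd h₁ hy'.ne'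
      · exact h₁
    refine ⟨‖z‖⁻¹ • z, ?_, ?_, ?_⟩
    · rw [norm_smul, norm_inv, norm_norm, inv_mul_cancel₀ (norm_ne_zero_iff.2 hz₀)]
    · rw [inner_smul_right, Submodule.mem_orthogonal_singleton_iff_inner_right.1 hz, mul_zero]
    · rw [hs, zero_smul, add_zero]
      simpa [hw₀] using hyw
  · have hw' := norm_ne_zero_iff.2 hw₀
    refine ⟨‖w‖⁻¹ • w, ?_, ?_, ?_⟩
    · rw [norm_smul, norm_inv, norm_norm, inv_mul_cancel₀ hw']
    · rw [inner_smul_right, hxw, mul_zero]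
    · rw [smul_add, smul_smul ‖y‖ (Real.sin φ), ← hwn, smul_smul ‖w‖ ‖w‖⁻¹, mul_inv_cancel₀ hw', one_smul]
      exact hyw

theorem geodesicDist_le_of_norm_deriv_le {S : Set E} {γ : ℝ → E} {C : ℝ} (hγ : ContDiff ℝ 1 γ)
    (hS : ∀ t, γ t ∈ S) (hC : ∀ t, ‖deriv γ t‖ ≤ C) :
    geodesicDist S (γ 0) (γ 1) ≤ ENNReal.ofReal C := by
  refine (iInf₂_le γ ⟨hγ.contDiffOn, fun t _ => hS t, rfl, rfl⟩).trans ?_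
  calc pathLength γ ≤ ∫⁻ _ in Icc (0 : ℝ) 1, ENNReal.ofReal C := by
        refine MeasureTheory.setLIntegral_mono measurable_const fun t ht => ?_
        rw [(hγ.differentiable one_ne_zero t).derivWithin (uniqueDiffOn_Icc_zero_one t ht),
          ← ofReal_norm]
        exact ENNReal.ofReal_le_ofReal (hC t)
    _ = ENNReal.ofReal C := by simp

theorem IsPinchedByBalls.exists_path_norm_deriv_le [FiniteDimensional ℝ E]
    (hE : 2 ≤ Module.finrank ℝ E) {S : Set E} {N : E → E} {ρ R : ℝ}
    (h : IsPinchedByBalls S N ρ R) {x y : E} (hx : x ∈ frontier S) (hy : y ∈ frontier S) :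
    ∃ γ : ℝ → E, ContDiff ℝ 1 γ ∧ (∀ t, γ t ∈ frontier S) ∧ γ 0 = x ∧ γ 1 = y ∧
      ∀ t, ‖deriv γ t‖ ≤ Real.pi * (R / ρ) * ‖y - x‖ := by
  have hx₀ := h.inner_pos.trans_le (h.le_norm hx)
  have hy₀ := h.inner_pos.trans_le (h.le_norm hy)
  obtain ⟨v, hv, hxv, hyv⟩ := exists_unit_orthogonal_angle hE (norm_pos_iff.1 hx₀)
    (norm_pos_iff.1 hy₀)
  obtain ⟨γ, h₁, h₂, h₃, h₄, h₅⟩ := h.exists_path (φ := InnerProductGeometry.angle x y) hx hv hxv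
  refine ⟨γ, h₁, h₂, h₃, ?_, fun t => (h₅ t).trans ?_⟩
  · rw [h₄, (eq_inv_smul_iff₀ hy₀.ne').2 hyv.symm, h.radialProj_smul hy (inv_pos.2 hy₀)]
  · have h₆ := h.angle_le hx hy
    rw [abs_of_nonneg (InnerProductGeometry.angle_nonneg x y)]
    have hρ := h.inner_pos
    have hR := h.outer_pos
    calc 2 * R * InnerProductGeometry.angle x y
        = R / ρ * (2 * ρ * InnerProductGeometry.angle x y) := by field_simp
      _ ≤ R / ρ * (Real.pi * ‖y - x‖) := by gcongr
      _ = _ := by ring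

/-! ### From radii of curvature to balls with a common normal -/

theorem closedBall_sub_smul_subset {x n : E} {r R : ℝ} (hn : ‖n‖ = 1) (h : r ≤ R) :
    closedBall (x - r • n) r ⊆ closedBall (x - R • n) R := by
  refine closedBall_subset_closedBall' ?_
  rw [dist_eq_norm, sub_sub_sub_cancel_left, ← sub_smul, norm_smul, hn, mul_one,
    Real.norm_of_nonneg (sub_nonneg.2 h)]
  linarith

/-- Nested balls whose boundaries share a point have the same normal there. -/
theorem eq_of_closedBall_sub_smul_subset {x n n' : E} {r R : ℝ} (hr : 0 < r) (hR : 0 < R)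
    (hn : ‖n‖ = 1) (hn' : ‖n'‖ = 1) (h : closedBall (x - r • n) r ⊆ closedBall (x - R • n') R) :
    n = n' := by
  -- The point of the small ball extreme in direction `n'` lies in the large ball only if `⟪n', n⟫ ≥
  -- 1`.
  have h₁ : x - r • n + r • n' ∈ closedBall (x - R • n') R := h (by
    rw [mem_closedBall, dist_eq_norm, add_sub_cancel_left, norm_smul, hn',
      Real.norm_of_nonneg hr.le, mul_one])
  rw [mem_closedBall, dist_eq_norm] at h₁
  have h₂ : ‖(R + r) • n' - r • n‖ ^ 2 ≤ R ^ 2 := by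
    rw [show (R + r) • n' - r • n = x - r • n + r • n' - (x - R • n') by module]
    gcongr
  rw [norm_sub_sq_real, norm_smul, norm_smul, inner_smul_left, inner_smul_right, hn, hn',
    Real.norm_eq_abs, Real.norm_eq_abs, mul_one, mul_one, sq_abs, sq_abs] at h₂
  have h₃ : 1 ≤ ⟪n', n⟫ := by
    have h₄ : (2 * (R + r) * r) * 1 ≤ (2 * (R + r) * r) * ⟪n', n⟫ := by
      simp only [conj_trivial] at h₂
      linarith
    exact le_of_mul_le_mul_left h₄ (by positivity)
  have h₅ := real_inner_le_norm n' n
  rw [hn, hn', one_mul] at h₅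
  exact ((inner_eq_one_iff_of_norm_eq_one hn' hn).1 (le_antisymm h₅ h₃)).symm

theorem exists_eq_sub_smul_of_mem_sphere {x c : E} {r : ℝ} (hr : 0 < r) (hx : x ∈ sphere c r) :
    ∃ n : E, ‖n‖ = 1 ∧ c = x - r • n := by
  rw [mem_sphere, dist_eq_norm] at hx
  refine ⟨r⁻¹ • (x - c), ?_, ?_⟩
  · rw [norm_smul, hx, Real.norm_of_nonneg (inv_pos.2 hr).le, inv_mul_cancel₀ hr.ne']
  · rw [smul_smul, mul_inv_cancel₀ hr.ne', one_smul, sub_sub_cancel]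

/-- If the inner radius of curvature at `x` exceeds `ρ` and the outer one is less than `R`, then
the set lies between a ball of radius `ρ` and one of radius `R` with a common normal at `x`. -/
theorem exists_normal_of_radiusOfCurvature [Nontrivial E] {K : Set E} (hK : Convex ℝ K) {x : E}
    {ρ R : ℝ} (hin : ENNReal.ofReal ρ < innerRadiusOfCurvature K x)
    (hout : outerRadiusOfCurvature K x < ENNReal.ofReal R) :
    ∃ n : E, ‖n‖ = 1 ∧ closedBall (x - ρ • n) ρ ⊆ K ∧ K ⊆ closedBall (x - R • n) R := by
  obtain ⟨_, ⟨c, r, ⟨hr, hxc, -⟩, hcK, rfl⟩, hρr⟩ := lt_sSup_iff.1 hin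
  obtain ⟨_, ⟨c', r', ⟨hr', hxc', -⟩, hcK', rfl⟩, hrR⟩ := sInf_lt_iff.1 hout
  rw [ENNReal.ofReal_lt_ofReal_iff hr] at hρr
  replace hrR := (ENNReal.ofReal_lt_ofReal_iff'.1 hrR).1
  -- A convex set containing the sphere contains the ball it bounds.
  replace hcK : closedBall c r ⊆ K := by
    rw [← convexHull_sphere_eq_closedBall c hr.le]
    exact convexHull_min hcK hK
  obtain ⟨n, hn, rfl⟩ := exists_eq_sub_smul_of_mem_sphere hr hxc
  obtain ⟨n', hn', rfl⟩ := exists_eq_sub_smul_of_mem_sphere hr' hxc'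
  obtain rfl := eq_of_closedBall_sub_smul_subset hr hr' hn hn' (hcK.trans hcK')
  exact ⟨n, hn, (closedBall_sub_smul_subset hn hρr.le).trans hcK,
    hcK'.trans (closedBall_sub_smul_subset hn hrR.le)⟩

theorem geodesicDist_frontier_le [FiniteDimensional ℝ E] (hE : 2 ≤ Module.finrank ℝ E)
    {K : Set E} (hK : Convex ℝ K) (hKc : IsCompact K) {ρ R : ℝ} (hρ : 0 < ρ) (hR : 0 < R)
    (hin : ∀ x ∈ frontier K, ENNReal.ofReal ρ < innerRadiusOfCurvature K x)
    (hout : ∀ x ∈ frontier K, outerRadiusOfCurvature K x < ENNReal.ofReal R)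
    {p q : E} (hp : p ∈ frontier K) (hq : q ∈ frontier K) :
    geodesicDist (frontier K) p q ≤ ENNReal.ofReal (Real.pi * (R / ρ) * ‖q - p‖) := by
  have : Nontrivial E := Module.nontrivial_of_finrank_pos (R := ℝ) (by omega)
  choose! N hN hNin hNout using fun x hx =>
    exists_normal_of_radiusOfCurvature hK (hin x hx) (hout x hx)
  -- The centre of the inner ball at `p` becomes the origin.
  set c := p - ρ • N p with hc
  let τ := Homeomorph.addLeft c
  have hτ : ∀ x, τ x = c + x := fun _ => rfl
  have hball : ∀ (z : E) (r : ℝ), τ ⁻¹' closedBall (c + z) r = closedBall z r := fun z r => by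
    ext x
    simp [hτ, dist_eq_norm]
  have hfr : τ ⁻¹' frontier K = frontier (τ ⁻¹' K) := τ.preimage_frontier K
  have hS : IsPinchedByBalls (τ ⁻¹' K) (fun x => N (τ x)) ρ R :=
    { convex := hK.translate_preimage_right c
      isClosed := hKc.isClosed.preimage τ.continuous
      isBounded := (τ.isCompact_preimage.2 hKc).isBounded
      inner_pos := hρ
      outer_pos := hR
      closedBall_subset := by
        rw [← hball 0 ρ, add_zero]
        exact preimage_mono (hNin p hp)
      norm_normal := fun x hx => hN _ (hfr.ge hx)
      inner_ball := fun x hx => by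
        rw [← hball, ← add_sub_assoc]
        exact preimage_mono (hNin _ (hfr.ge hx))
      outer_ball := fun x hx => by
        rw [← hball, ← add_sub_assoc]
        exact preimage_mono (hNout _ (hfr.ge hx)) }
  have hmem : ∀ x ∈ frontier K, x - c ∈ frontier (τ ⁻¹' K) := fun x hx => by
    rw [← hfr, mem_preimage, hτ, add_sub_cancel]
    exact hx
  obtain ⟨γ, h₁, h₂, h₃, h₄, h₅⟩ := hS.exists_path_norm_deriv_le hE (hmem p hp) (hmem q hq)
  have h₆ := geodesicDist_le_of_norm_deriv_le (S := frontier K) (γ := fun t => c + γ t)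
    (contDiff_const.add h₁) (fun t => hfr.ge (h₂ t)) (fun t => by rw [deriv_const_add]; exact h₅ t)
  simpa [h₃, h₄] using h₆

end RollingBalls

theorem mainTheorem9 (d : ℕ) (hd : 1 ≤ d) (K : ConvexBody (EuclideanSpace ℝ (Fin (d + 1))))
    (m₂ M₂ : ℝ) (hm : 0 < m₂) (hM : 0 < M₂)
    (hinner : ∀ x ∈ frontier (K : Set (EuclideanSpace ℝ (Fin (d + 1)))),
      ENNReal.ofReal (1 / √M₂) ≤ innerRadiusOfCurvature (K : Set (EuclideanSpace ℝ (Fin (d + 1)))) x)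
    (houter : ∀ x ∈ frontier (K : Set (EuclideanSpace ℝ (Fin (d + 1)))),
      outerRadiusOfCurvature (K : Set (EuclideanSpace ℝ (Fin (d + 1)))) x ≤ ENNReal.ofReal (1 / √m₂))
    (q₁ q₂ : EuclideanSpace ℝ (Fin (d + 1)))
    (hq₁ : q₁ ∈ frontier (K : Set (EuclideanSpace ℝ (Fin (d + 1)))))
    (hq₂ : q₂ ∈ frontier (K : Set (EuclideanSpace ℝ (Fin (d + 1))))) :
    geodesicDist (frontier (K : Set (EuclideanSpace ℝ (Fin (d + 1))))) q₁ q₂ ≤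
      ENNReal.ofReal (2 * Real.pi * (√M₂ / √m₂) * ‖q₂ - q₁‖) := by
  have hr : 0 < 1 / √M₂ := by positivity
  have hR : 0 < 1 / √m₂ := by positivity
  -- Strict inequalities avoid any need for the extremal radii to be attained. The factors `2/3` and
  -- `4/3` have ratio `2`, which turns `π` into `2 π`.
  have hlt : 2 / 3 * (1 / √M₂) < 1 / √M₂ := by linarith
  have hgt : 1 / √m₂ < 4 / 3 * (1 / √m₂) := by linarith
  have h := geodesicDist_frontier_le (by simpa using hd) K.convex K.isCompact
    (mul_pos (by norm_num) hr) (mul_pos (by norm_num) hR)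
    (fun x hx => ((ENNReal.ofReal_lt_ofReal_iff hr).2 hlt).trans_le (hinner x hx))
    (fun x hx => (houter x hx).trans_lt ((ENNReal.ofReal_lt_ofReal_iff (hR.trans hgt)).2 hgt))
    hq₁ hq₂
  convert h using 2
  have h₁ : √M₂ ≠ 0 := by positivity
  have h₂ : √m₂ ≠ 0 := by positivity
  field_simp
  ring
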